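/- Let $K$ be a number field and let $\mathbb{A}_{\mathbb{Q}}$, $\mathbb{A}_K$ be the adele rings of $\mathbb{Q}$ and $K$. Let $\mathbb{A}_{\mathbb{Q}}\hookrightarrow\mathbb{A}_K$ be the canonical embedding, whose component at a place $v$ of $K$ is the continuous embedding $\mathbb{Q}_u\hookrightarrow K_v$ applied to the component at the place $u$ of $\mathbb{Q}$ below $v$. Let $\Omega$ and $\tilde\Omega$ be the sets of finite places of $\mathbb{Q}$ and of $K$, and let $r:\tilde\Omega\to\Omega$ be the restriction map. For $F\in\{\mathbb{Q},K\}$ and a finite place $v$ of $F$, let $\mathfrak{m}_v$ be the maximal ideal of the valuation ring of the completion $F_v$. For an ultrafilter $\mathcal{U}$ on the set of finite places of $F$, put \[ M_{\mathcal{U}}=\{\alpha\in\mathbb{A}_F \mid \{v \mid \alpha_v\in\mathfrak{m}_v\}\in\mathcal{U}\}, \] and for $\beta\in\mathbb{A}_F$ put \[ \mathfrak{p}_{\mathcal{U}}^{\beta}=\{\alpha\in\mathbb{A}_F \mid \text{there are } Y\in\mathcal{U} \text{ and an integer } n\ge 1 \text{ such that } v(\alpha_v^n)\ge v(\beta_v)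 \text{ for all } v\in Y\}. \] Let $\mathcal{U}$ be a non-principal ultrafilter on $\Omega$, let $\mathfrak{p}$ be a prime ideal of $\mathbb{A}_{\mathbb{Q}}$ with $\mathfrak{p}\subseteq M_{\mathcal{U}}$, and let $\tilde{\mathcal{U}}$ be an ultrafilter on $\tilde\Omega$ such that $r(\tilde{\mathcal{U}})=\mathcal{U}$, where $r(\tilde{\mathcal{U}})=\{r(W)\mid W\in\tilde{\mathcal{U}}\}$ is the image ultrafilter. Then there is exactly one prime ideal $\tilde{\mathfrak{p}}$ of $\mathbb{A}_K$ such that $\tilde{\mathfrak{p}}\subseteq M_{\tilde{\mathcal{U}}}$ and $\tilde{\mathfrak{p}}\cap\mathbb{A}_{\mathbb{Q}}=\mathfrak{p}$, and it is given by \[ \tilde{\mathfrak{p}}=\bigcup_{\beta\in\mathfrak{p}}\mathfrak{p}_{\tilde{\mathcal{U}}}^{\beta}, \] where $\beta\in\mathfrak{p}\subseteq\mathbb{A}_{\mathbb{Q}}$ is regarded as an element of $\mathbb{A}_K$. -/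

import Mathlib

open NumberField IsDedekindDomain HeightOneSpectrum

namespace AdelePrimes

noncomputable section

/-! ### The canonical homomorphism of adele rings attached to an extension of number fields -/

/-- The restriction map `r` from the finite places of `K` to the finite places of `F`;
the finite places are indexed by the nonzero primes of the ring of integers, and a prime `P` is
sent to `P ∩ 𝓞 F`. -/
def restrictPlace (F : Type*) {K : Type*} [Field F] [Field K] [Algebra F K]
    (w : HeightOneSpectrum (𝓞 K)) : HeightOneSpectrum (𝓞 F) :=
  w.under (𝓞 F)

theorem restrictPlace_liesOver (F : Type*) {K : Type*} [Field F] [Field K] [Algebra F K]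
    (w : HeightOneSpectrum (𝓞 K)) :
    w.asIdeal.LiesOver (restrictPlace F w).asIdeal :=
  ⟨rfl⟩

theorem comap_liesOver (F : Type*) {K : Type*} [Field F] [Field K] [Algebra F K]
    (w : InfinitePlace K) : w.LiesOver (w.comap (algebraMap F K)) :=
  ⟨rfl⟩

section Extension

variable (F K : Type*) [Field F] [NumberField F] [Field K] [NumberField K] [Algebra F K]

theorem tendsto_restrictPlace :
    Filter.Tendsto (restrictPlace F (K := K)) Filter.cofinite Filter.cofinite := by
  refine Filter.Tendsto.cofinite_of_finite_preimage_singleton fun v => ?_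
  refine Set.Finite.of_finite_image (f := HeightOneSpectrum.asIdeal) ?_
    (fun _ _ _ _ h => HeightOneSpectrum.ext h)
  refine (IsDedekindDomain.primesOver_finite v.asIdeal (𝓞 K)).subset ?_
  rintro _ ⟨w, rfl, rfl⟩
  exact ⟨w.isPrime, restrictPlace_liesOver F w⟩

/-- The continuous extension `F_v → K_w` of `F → K`, for a finite place `w` of `K`
and `v = r(w)`. -/
def finiteCompletionMap (w : HeightOneSpectrum (𝓞 K)) :
    (restrictPlace F w).adicCompletion F →+* w.adicCompletion K :=
  haveI := restrictPlace_liesOver F w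
  ((adicCompletion.equiv K w).symm.toRingHom.comp
    (UniformSpace.Completion.mapRingHom
      (algebraMap (WithVal ((restrictPlace F w).valuation F)) (WithVal (w.valuation K)))
      (uniformContinuous_algebraMap_liesOver F K (restrictPlace F w) w).continuous)).comp
    (adicCompletion.equiv F (restrictPlace F w)).toRingHom

theorem continuous_finiteCompletionMap (w : HeightOneSpectrum (𝓞 K)) :
    Continuous (finiteCompletionMap F K w) :=
  (adicCompletion.continuous_ofCompletion K w).comp <|
    UniformSpace.Completion.continuous_map.comp
      (adicCompletion.continuous_toCompletion F (restrictPlace F w))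

theorem finiteCompletionMap_coe (w : HeightOneSpectrum (𝓞 K)) (x : F) :
    finiteCompletionMap F K w (x : (restrictPlace F w).adicCompletion F) =
      ((algebraMap F K x : K) : w.adicCompletion K) := by
  have := restrictPlace_liesOver F w
  apply adicCompletion.ext
  exact UniformSpace.Completion.mapRingHom_coe
    (uniformContinuous_algebraMap_liesOver F K (restrictPlace F w) w).continuous _

theorem finiteCompletionMap_mem_integers (w : HeightOneSpectrum (𝓞 K)) :
    Set.MapsTo (finiteCompletionMap F K w)
      ((restrictPlace F w).adicCompletionIntegers F) (w.adicCompletionIntegers K) := by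
  have := restrictPlace_liesOver F w
  have hclosed : IsClosed {x : (restrictPlace F w).adicCompletion F |
      x ∈ (restrictPlace F w).adicCompletionIntegers F →
        finiteCompletionMap F K w x ∈ w.adicCompletionIntegers K} := by
    refine isClosed_imp ?_ ?_
    · exact Valued.isOpen_valuationSubring _
    · exact (Valued.isClosed_valuationSubring _).preimage (continuous_finiteCompletionMap F K w)
  have hall := (denseRange_algebraMap F (restrictPlace F w)).induction_on (p := fun x =>
      x ∈ (restrictPlace F w).adicCompletionIntegers F →
        finiteCompletionMap F K w x ∈ w.adicCompletionIntegers K)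
  refine fun x hx => hall x hclosed (fun a ha => ?_) hx
  have ha' : (restrictPlace F w).valuation F a ≤ 1 := by
    rw [← valuedAdicCompletion_eq_valuation']
    exact ha
  have h2 := finiteCompletionMap_coe F K w a
  rw [mem_adicCompletionIntegers]
  erw [h2]
  rw [valuedAdicCompletion_eq_valuation', ← valuation_liesOver K (restrictPlace F w) w]
  exact pow_le_one₀ zero_le ha'

/-- The finite part of the homomorphism of adele rings: `(x_v)_v ↦ (x_{r(w)})_w`. -/
def finiteAdeleMap : FiniteAdeleRing (𝓞 F) F →+* FiniteAdeleRing (𝓞 K) K :=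
  RestrictedProduct.mapAlongRingHom
    (fun v : HeightOneSpectrum (𝓞 F) => v.adicCompletion F)
    (fun w : HeightOneSpectrum (𝓞 K) => w.adicCompletion K)
    (B₁ := fun v : HeightOneSpectrum (𝓞 F) => v.adicCompletionIntegers F)
    (B₂ := fun w : HeightOneSpectrum (𝓞 K) => w.adicCompletionIntegers K)
    (restrictPlace F (K := K)) (tendsto_restrictPlace F K) (finiteCompletionMap F K)
    (Filter.Eventually.of_forall (finiteCompletionMap_mem_integers F K))

/-- The Archimedean part of the homomorphism of adele rings. -/
def infiniteAdeleMap : InfiniteAdeleRing F →+* InfiniteAdeleRing K :=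
  RingHom.pi fun w : InfinitePlace K =>
    haveI := comap_liesOver F w
    (NumberField.LiesOver.completionMap
      (v := w.comap (algebraMap F K)) (w := w)).comp
      (Pi.evalRingHom (fun v : InfinitePlace F => v.Completion) (w.comap (algebraMap F K)))

/-- The canonical ring homomorphism `𝔸_F → 𝔸_K`: its component at a place `w` of `K` is the
continuous map `F_v → K_w` applied to the component at the place `v` of `F` below `w`. -/
def adeleMap : AdeleRing (𝓞 F) F →+* AdeleRing (𝓞 K) K :=
  (infiniteAdeleMap F K).prodMap (finiteAdeleMap F K)

end Extension

/-! ### Ultrafilters and the sets `M_U` and `p_U^β` -/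

/-- An ultrafilter is principal if some point belongs to all of its members. -/
def IsPrincipal {Ω : Type*} (U : Ultrafilter Ω) : Prop :=
  ∃ ω : Ω, ∀ s ∈ U, ω ∈ s

section Ideals

variable {K : Type*} [Field K] [NumberField K]

/-- `M_U`, the set of adeles `α` such that `α_v ∈ 𝔪_v` for `U`-almost all finite places `v`.
The valuation of `K_v` is written multiplicatively, so `α_v ∈ 𝔪_v` means that its
value is `< 1`. -/
def maximalSet (U : Ultrafilter (HeightOneSpectrum (𝓞 K))) : Set (AdeleRing (𝓞 K) K) :=
  {α | {v : HeightOneSpectrum (𝓞 K) | Valued.v (α.2 v) < 1} ∈ U}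

/-- `p_U^β`, the set of adeles `α` for which there are `Y ∈ U` and `n ≥ 1` with
`v(α_v ^ n) ≥ v(β_v)` for all `v ∈ Y`; the additive inequality is reversed
because the valuation of `K_v` is written multiplicatively. -/
def primeSet (U : Ultrafilter (HeightOneSpectrum (𝓞 K))) (β : AdeleRing (𝓞 K) K) :
    Set (AdeleRing (𝓞 K) K) :=
  {α | ∃ Y ∈ U, ∃ n : ℕ, 1 ≤ n ∧ ∀ v ∈ Y, Valued.v (α.2 v ^ n) ≤ Valued.v (β.2 v)}

end Ideals

end

end AdelePrimes

/-!
For a finite place `v` write `|x|_v` for the multiplicatively written valuation. Modulo an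
ultrafilter `U` the sizes `|α_v|` of two adeles are always comparable, and a prime ideal `p`
contained in `M_U` only depends on these sizes: if `β ∈ p` and `|α_v| ≤ |β_v|` for `U`-almost all
`v`, then `α` becomes a multiple of `β` after multiplication by an idempotent that is `1` on a
member of `U`, and this idempotent lies outside `M_U`
(`mem_of_eventually_valuation_le`). Hence `p` contains `p_U^β` for each `β ∈ p`.

Existence. If `V` contains the cofinite sets, almost all components of an adele are integral, so a
union of sets `p_V^β` is closed under multiplication by adeles; comparability modulo `V` makes it
closed under addition and prime (`unionIdeal`, `unionIdeal_isPrime`). That the union over `p`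
contracts to `p` follows from the formula `|x|_w = |x|_v ^ e(w/v)` for `x ∈ F_v` and from the
description of `p` above.

Uniqueness. A prime `q'` over `p` contains all `p_V^β` with `β ∈ p`. Conversely, the fibres of the
restriction map `r` have at most `[K : F]` elements, so `r` is injective on some `W ∈ V`
(`exists_mem_injOn`). Given `α ∈ q'` this allows to choose an adele `β` of `F` with
`|β_{r(w)}|_{r(w)} = |α_w|_w` for almost all `w`. Since `1 ≤ e ≤ [K : F]`, the image of `β` satisfies
`|α_w| ^ [K : F] ≤ |β_w| ≤ |α_w|`; the second inequality gives `β ∈ p`, the first `α ∈ p_V^β`.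
-/

namespace AdelePrimes

open Filter

/-! ### Ultrafilters and maps with bounded fibres -/

theorem le_cofinite_of_not_isPrincipal {X : Type*} {U : Ultrafilter X} (hU : ¬ IsPrincipal U) :
    (U : Filter X) ≤ cofinite := by
  refine U.le_cofinite_or_eq_pure.resolve_right ?_
  rintro ⟨a, rfl⟩
  exact hU ⟨a, fun s hs => hs⟩

theorem le_cofinite_of_map_le_cofinite {X Y : Type*} {V : Ultrafilter X} {f : X → Y}
    (h : (V.map f : Filter Y) ≤ cofinite) : (V : Filter X) ≤ cofinite := by
  refine V.le_cofinite_or_eq_pure.resolve_right ?_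
  rintro ⟨a, rfl⟩
  have h1 : ({f a}ᶜ : Set Y) ∈ (Ultrafilter.map f (pure a) : Filter Y) :=
    h (Set.finite_singleton (f a)).compl_mem_cofinite
  exact h1 rfl

/-- The domain of a map with fibres of at most `N` elements is a union of `N` sets on each of which
the map is injective, and one of these belongs to the ultrafilter. -/
theorem exists_mem_injOn {X Y : Type*} (V : Ultrafilter X) (f : X → Y) (N : ℕ)
    (hf : ∀ y, (f ⁻¹' {y}).encard ≤ N) : ∃ W ∈ V, Set.InjOn f W := by
  have hemb (y : Y) : Nonempty (f ⁻¹' {y} ↪ Fin N) := by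
    have hfin : (f ⁻¹' {y}).Finite := Set.finite_of_encard_le_coe (hf y)
    have := hfin.fintype
    refine Function.Embedding.nonempty_of_card_le ?_
    rw [Fintype.card_fin, ← Set.toFinset_card, ← Set.ncard_eq_toFinset_card']
    exact_mod_cast hfin.cast_ncard_eq.trans_le (hf y)
  let g (x : X) : Fin N := (hemb (f x)).some ⟨x, rfl⟩
  obtain ⟨i, hi⟩ := (Ultrafilter.eventually_exists_iff (f := V) (P := fun i x => g x = i)).1
    (Eventually.of_forall fun x => ⟨g x, rfl⟩)
  refine ⟨{x | g x = i}, hi, fun x hx x' hx' hxx' => ?_⟩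
  have h2 (y : Y) (hy : f x' = y) : g x' = (hemb y).some ⟨x', hy⟩ := by subst hy; rfl
  have h3 : (hemb (f x)).some ⟨x, rfl⟩ = (hemb (f x)).some ⟨x', hxx'.symm⟩ :=
    (hx.trans hx'.symm).trans (h2 (f x) hxx'.symm)
  exact congrArg Subtype.val ((hemb (f x)).some.injective h3)

/-! ### Local degrees in an extension of number fields -/

section Extension

variable (F K : Type*) [Field F] [Field K] [NumberField K] [Algebra F K]

/-- The ramification index of a finite place `w` of `K` over the place `r(w)` of `F`. -/
noncomputable def placeRamificationIdx (w : HeightOneSpectrum (𝓞 K)) : ℕ :=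
  (restrictPlace F w).asIdeal.ramificationIdx' w.asIdeal

theorem placeRamificationIdx_ne_zero (w : HeightOneSpectrum (𝓞 K)) :
    placeRamificationIdx F K w ≠ 0 :=
  have := restrictPlace_liesOver F w
  Ideal.IsDedekindDomain.ramificationIdx'_ne_zero_of_liesOver w.asIdeal (restrictPlace F w).ne_bot

variable [NumberField F]

theorem one_le_ramificationIdx_mul_inertiaDeg (v : HeightOneSpectrum (𝓞 F))
    (P : v.asIdeal.primesOver (𝓞 K)) :
    1 ≤ P.1.ramificationIdx (𝓞 F) * P.1.inertiaDeg (𝓞 F) :=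
  have := P.2.1
  Nat.mul_pos (Ideal.ramificationIdx_pos ..) (Ideal.inertiaDeg_pos ..)

theorem encard_restrictPlace_fiber_le (v : HeightOneSpectrum (𝓞 F)) :
    (restrictPlace F (K := K) ⁻¹' {v}).encard ≤ Module.finrank (𝓞 F) (𝓞 K) := by
  have hfin : (v.asIdeal.primesOver (𝓞 K)).Finite :=
    IsDedekindDomain.primesOver_finite v.asIdeal (𝓞 K)
  have := hfin.fintype
  have hinj : Function.Injective (HeightOneSpectrum.asIdeal (R := 𝓞 K)) :=
    fun _ _ h => HeightOneSpectrum.ext h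
  rw [← hinj.encard_image]
  refine (Set.encard_le_encard (t := v.asIdeal.primesOver (𝓞 K)) ?_).trans ?_
  · rintro _ ⟨w, rfl, rfl⟩
    exact ⟨w.isPrime, restrictPlace_liesOver F w⟩
  · rw [← hfin.cast_ncard_eq, Set.ncard_eq_toFinset_card', Set.toFinset_card,
      ← Ideal.sum_ramification_inertia_eq_finrank v.asIdeal (𝓞 K), ← Finset.card_univ,
      Finset.card_eq_sum_ones]
    exact_mod_cast Finset.sum_le_sum fun P _ => one_le_ramificationIdx_mul_inertiaDeg F K v P

theorem placeRamificationIdx_le (w : HeightOneSpectrum (𝓞 K)) :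
    placeRamificationIdx F K w ≤ Module.finrank (𝓞 F) (𝓞 K) := by
  have hw := restrictPlace_liesOver F w
  have hfin : ((restrictPlace F w).asIdeal.primesOver (𝓞 K)).Finite :=
    IsDedekindDomain.primesOver_finite _ (𝓞 K)
  have := hfin.fintype
  rw [placeRamificationIdx,
    Ideal.ramificationIdx'_eq_ramificationIdx _ _ (restrictPlace F w).ne_bot,
    ← Ideal.sum_ramification_inertia_eq_finrank (restrictPlace F w).asIdeal (𝓞 K)]
  let P : (restrictPlace F w).asIdeal.primesOver (𝓞 K) := ⟨w.asIdeal, w.isPrime, hw⟩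
  calc w.asIdeal.ramificationIdx (𝓞 F)
      ≤ P.1.ramificationIdx (𝓞 F) * P.1.inertiaDeg (𝓞 F) :=
        Nat.le_mul_of_pos_right _
          (Nat.pos_of_mul_pos_left (one_le_ramificationIdx_mul_inertiaDeg F K _ P))
    _ ≤ _ := Finset.single_le_sum
        (f := fun P : (restrictPlace F w).asIdeal.primesOver (𝓞 K) =>
          P.1.ramificationIdx (𝓞 F) * P.1.inertiaDeg (𝓞 F))
        (fun _ _ => Nat.zero_le _) (Finset.mem_univ P)

theorem valuation_finiteCompletionMap (w : HeightOneSpectrum (𝓞 K))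
    (x : (restrictPlace F w).adicCompletion F) :
    Valued.v (finiteCompletionMap F K w x) = Valued.v x ^ placeRamificationIdx F K w := by
  have := restrictPlace_liesOver F w
  rcases eq_or_ne x 0 with rfl | hx
  · simp [placeRamificationIdx_ne_zero F K w]
  -- Both sides are locally constant near `x ≠ 0`, so `x` may be replaced by an element of `F`.
  have h1 : {y | Valued.v y = Valued.v x} ∈ nhds x :=
    Valued.locally_const (by simpa using hx)
  have h2 : {y | Valued.v (finiteCompletionMap F K w y) =
      Valued.v (finiteCompletionMap F K w x)} ∈ nhds x :=
    (continuous_finiteCompletionMap F K w).continuousAt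
      (Valued.locally_const (by simpa using hx))
  obtain ⟨_, ⟨ha1, ha2⟩, a, rfl⟩ := mem_closure_iff_nhds.1
    (denseRange_algebraMap F (restrictPlace F w) x) _ (inter_mem h1 h2)
  have h3 := finiteCompletionMap_coe F K w a
  have h4 : Valued.v (finiteCompletionMap F K w (algebraMap F _ a)) =
      w.valuation K (algebraMap F K a) := by
    erw [h3]
    exact valuedAdicCompletion_eq_valuation' ..
  have h5 : Valued.v (algebraMap F ((restrictPlace F w).adicCompletion F) a) =
      (restrictPlace F w).valuation F a := valuedAdicCompletion_eq_valuation' ..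
  rw [Set.mem_ofPred_eq] at ha1 ha2
  rw [← ha1, ← ha2, h4, h5, placeRamificationIdx, valuation_liesOver K (restrictPlace F w) w]

theorem valuation_adeleMap (x : AdeleRing (𝓞 F) F) (w : HeightOneSpectrum (𝓞 K)) :
    Valued.v ((adeleMap F K x).2 w) =
      Valued.v (x.2 (restrictPlace F w)) ^ placeRamificationIdx F K w :=
  valuation_finiteCompletionMap F K w _

end Extension

/-! ### Prime ideals contained in `M_U` -/

section Ideals

variable {K : Type*} [Field K] [NumberField K]

theorem mem_maximalSet {U : Ultrafilter (HeightOneSpectrum (𝓞 K))} {α : AdeleRing (𝓞 K) K} :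
    α ∈ maximalSet U ↔ ∀ᶠ v in U, Valued.v (α.2 v) < 1 :=
  Iff.rfl

theorem mem_primeSet {U : Ultrafilter (HeightOneSpectrum (𝓞 K))} {α β : AdeleRing (𝓞 K) K} :
    α ∈ primeSet U β ↔ ∃ n : ℕ, 1 ≤ n ∧ ∀ᶠ v in U, Valued.v (α.2 v) ^ n ≤ Valued.v (β.2 v) := by
  simp only [← map_pow]
  constructor
  · rintro ⟨Y, hY, n, hn, h⟩
    exact ⟨n, hn, mem_of_superset hY h⟩
  · rintro ⟨n, hn, h⟩
    exact ⟨_, h, n, hn, fun v hv => hv⟩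

theorem eventually_valuation_le_one {U : Filter (HeightOneSpectrum (𝓞 K))} (hU : U ≤ cofinite)
    (α : AdeleRing (𝓞 K) K) : ∀ᶠ v in U, Valued.v (α.2 v) ≤ 1 :=
  hU α.2.2

theorem adele_mul_apply (α β : AdeleRing (𝓞 K) K) (v : HeightOneSpectrum (𝓞 K)) :
    (α * β).2 v = α.2 v * β.2 v := rfl

theorem adele_zero_apply (v : HeightOneSpectrum (𝓞 K)) :
    (0 : AdeleRing (𝓞 K) K).2 v = 0 := rfl

/-- The adele with prescribed integral components at the finite places and with component `0` at
the infinite places. -/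
noncomputable def integralAdele (f : ∀ v : HeightOneSpectrum (𝓞 K), v.adicCompletion K)
    (hf : ∀ v, Valued.v (f v) ≤ 1) : AdeleRing (𝓞 K) K :=
  (0, ⟨f, Eventually.of_forall hf⟩)

theorem integralAdele_apply (f : ∀ v : HeightOneSpectrum (𝓞 K), v.adicCompletion K)
    (hf : ∀ v, Valued.v (f v) ≤ 1) (v : HeightOneSpectrum (𝓞 K)) :
    (integralAdele f hf).2 v = f v := rfl

theorem integralAdele_mul_eq {f g : ∀ v : HeightOneSpectrum (𝓞 K), v.adicCompletion K}
    {hf : ∀ v, Valued.v (f v) ≤ 1} {hg : ∀ v, Valued.v (g v) ≤ 1} {α β : AdeleRing (𝓞 K) K}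
    (h : ∀ v, f v * α.2 v = g v * β.2 v) : integralAdele f hf * α = integralAdele g hg * β := by
  refine Prod.ext ?_ (FiniteAdeleRing.ext _ h)
  exact (zero_mul α.1).trans (zero_mul β.1).symm

open Classical in
/-- Membership in a prime ideal contained in `M_U` only depends on the sizes of the components at
`U`-almost all finite places. -/
theorem mem_of_eventually_valuation_le {U : Ultrafilter (HeightOneSpectrum (𝓞 K))}
    {p : Ideal (AdeleRing (𝓞 K) K)} (hp : p.IsPrime)
    (hpU : (p : Set (AdeleRing (𝓞 K) K)) ⊆ maximalSet U) {α β : AdeleRing (𝓞 K) K} (hβ : β ∈ p)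
    (h : ∀ᶠ v in U, Valued.v (α.2 v) ≤ Valued.v (β.2 v)) : α ∈ p := by
  set Y : Set (HeightOneSpectrum (𝓞 K)) := {v | Valued.v (α.2 v) ≤ Valued.v (β.2 v)}
  let e (v : HeightOneSpectrum (𝓞 K)) : v.adicCompletion K := if v ∈ Y then 1 else 0
  let g (v : HeightOneSpectrum (𝓞 K)) : v.adicCompletion K := if v ∈ Y then α.2 v / β.2 v else 0
  have he (v) : Valued.v (e v) ≤ 1 := by
    by_cases hv : v ∈ Y <;> simp [e, hv]
  have hg (v) : Valued.v (g v) ≤ 1 := by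
    by_cases hv : v ∈ Y
    · simpa [g, hv] using div_le_one_of_le₀ hv zero_le
    · simp [g, hv]
  have heq : integralAdele e he * α = integralAdele g hg * β := by
    refine integralAdele_mul_eq fun v => ?_
    by_cases hv : v ∈ Y
    · by_cases hb : β.2 v = 0
      · have ha : α.2 v = 0 := by
          have : Valued.v (α.2 v) ≤ Valued.v (β.2 v) := hv
          simpa [hb] using this
        rw [ha, hb, mul_zero, mul_zero]
      · simp [e, g, hv, hb]
    · simp [e, g, hv]
  refine (hp.mem_or_mem (heq ▸ p.mul_mem_left _ hβ)).resolve_left fun hmem => ?_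
  obtain ⟨v, hv1, hv2⟩ := ((mem_maximalSet.1 (hpU hmem)).and h).exists
  have hv : v ∈ Y := hv2
  simp [integralAdele_apply, e, hv] at hv1

theorem primeSet_subset {U : Ultrafilter (HeightOneSpectrum (𝓞 K))}
    {p : Ideal (AdeleRing (𝓞 K) K)} (hp : p.IsPrime)
    (hpU : (p : Set (AdeleRing (𝓞 K) K)) ⊆ maximalSet U) {β : AdeleRing (𝓞 K) K} (hβ : β ∈ p) :
    primeSet U β ⊆ p := by
  intro α hα
  obtain ⟨Y, hY, n, -, h⟩ := hα
  exact hp.mem_of_pow_mem n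
    (mem_of_eventually_valuation_le hp hpU (α := α ^ n) hβ (mem_of_superset hY h))

/-- The union of the sets `p_V^β` for `β` in a nonempty set `B` of adeles, as an ideal; `V` is
required to contain the cofinite sets. -/
def unionIdeal (V : Ultrafilter (HeightOneSpectrum (𝓞 K)))
    (hV : (V : Filter (HeightOneSpectrum (𝓞 K))) ≤ cofinite) (B : Set (AdeleRing (𝓞 K) K))
    (hB : B.Nonempty) : Ideal (AdeleRing (𝓞 K) K) where
  carrier := ⋃ β ∈ B, primeSet V β
  zero_mem' := by
    obtain ⟨β, hβ⟩ := hB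
    refine Set.mem_biUnion hβ (mem_primeSet.2 ⟨1, le_rfl, Eventually.of_forall fun v => ?_⟩)
    simp [adele_zero_apply]
  add_mem' := by
    intro α α' hα hα'
    simp only [Set.mem_iUnion₂, mem_primeSet, exists_prop] at hα hα' ⊢
    obtain ⟨β, hβ, n, hn, h⟩ := hα
    obtain ⟨β', hβ', n', hn', h'⟩ := hα'
    rcases Ultrafilter.eventually_or.1
      (Eventually.of_forall fun v => le_total (Valued.v (α.2 v)) (Valued.v (α'.2 v)) :
        ∀ᶠ v in V, _ ∨ _) with hle | hle
    · refine ⟨β', hβ', n', hn', ?_⟩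
      filter_upwards [h', hle] with v h1 h2
      exact (pow_le_pow_left₀ zero_le
        ((Valued.v.map_add _ _).trans (max_le h2 le_rfl)) n').trans h1
    · refine ⟨β, hβ, n, hn, ?_⟩
      filter_upwards [h, hle] with v h1 h2
      exact (pow_le_pow_left₀ zero_le
        ((Valued.v.map_add _ _).trans (max_le le_rfl h2)) n).trans h1
  smul_mem' := by
    intro γ α hα
    simp only [Set.mem_iUnion₂, mem_primeSet, exists_prop] at hα ⊢
    obtain ⟨β, hβ, n, hn, h⟩ := hα
    refine ⟨β, hβ, n, hn, ?_⟩
    filter_upwards [h, eventually_valuation_le_one hV γ] with v h1 h2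
    refine (pow_le_pow_left₀ zero_le ?_ n).trans h1
    rw [smul_eq_mul, adele_mul_apply, map_mul]
    exact mul_le_of_le_one_left zero_le h2

theorem mem_unionIdeal {V : Ultrafilter (HeightOneSpectrum (𝓞 K))}
    {hV : (V : Filter (HeightOneSpectrum (𝓞 K))) ≤ cofinite} {B : Set (AdeleRing (𝓞 K) K)}
    {hB : B.Nonempty} {α : AdeleRing (𝓞 K) K} :
    α ∈ unionIdeal V hV B hB ↔
      ∃ β ∈ B, ∃ n : ℕ, 1 ≤ n ∧ ∀ᶠ v in V, Valued.v (α.2 v) ^ n ≤ Valued.v (β.2 v) := by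
  change α ∈ ⋃ β ∈ B, primeSet V β ↔ _
  simp only [Set.mem_iUnion₂, mem_primeSet, exists_prop]

theorem unionIdeal_subset_maximalSet {V : Ultrafilter (HeightOneSpectrum (𝓞 K))}
    (hV : (V : Filter (HeightOneSpectrum (𝓞 K))) ≤ cofinite) {B : Set (AdeleRing (𝓞 K) K)}
    (hB : B.Nonempty) (hBV : B ⊆ maximalSet V) :
    (unionIdeal V hV B hB : Set (AdeleRing (𝓞 K) K)) ⊆ maximalSet V := by
  intro α hα
  obtain ⟨β, hβ, n, -, h⟩ := mem_unionIdeal.1 hα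
  refine mem_maximalSet.2 ?_
  filter_upwards [h, mem_maximalSet.1 (hBV hβ)] with v h1 h2
  by_contra! h3
  exact ((one_le_pow₀ h3).trans h1).not_gt h2

theorem unionIdeal_isPrime {V : Ultrafilter (HeightOneSpectrum (𝓞 K))}
    (hV : (V : Filter (HeightOneSpectrum (𝓞 K))) ≤ cofinite) {B : Set (AdeleRing (𝓞 K) K)}
    (hB : B.Nonempty) (hBV : B ⊆ maximalSet V) : (unionIdeal V hV B hB).IsPrime := by
  refine ⟨fun htop => ?_, fun {α α'} hmul => ?_⟩
  · have h1 : (1 : AdeleRing (𝓞 K) K) ∈ maximalSet V :=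
      unionIdeal_subset_maximalSet hV hB hBV (htop ▸ Submodule.mem_top)
    obtain ⟨v, hv⟩ := (mem_maximalSet.1 h1).exists
    exact hv.ne (map_one Valued.v)
  · obtain ⟨β, hβ, n, hn, h⟩ := mem_unionIdeal.1 hmul
    simp only [mem_unionIdeal]
    -- The smaller factor `x` of a product `x * y` satisfies `|x| ^ (2 * n) ≤ |x * y| ^ n`.
    rcases Ultrafilter.eventually_or.1
      (Eventually.of_forall fun v => le_total (Valued.v (α.2 v)) (Valued.v (α'.2 v)) :
        ∀ᶠ v in V, _ ∨ _) with hle | hle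
    · refine Or.inl ⟨β, hβ, 2 * n, by lia, ?_⟩
      filter_upwards [h, hle] with v h1 h2
      refine le_trans ?_ h1
      rw [pow_mul, adele_mul_apply, map_mul, sq]
      gcongr
    · refine Or.inr ⟨β, hβ, 2 * n, by lia, ?_⟩
      filter_upwards [h, hle] with v h1 h2
      refine le_trans ?_ h1
      rw [pow_mul, adele_mul_apply, map_mul, sq]
      gcongr

end Ideals

/-! ### Primes above a given prime -/

section Extension

variable {F K : Type*} [Field F] [NumberField F] [Field K] [NumberField K] [Algebra F K]

open Classical in
/-- On a member of `V` where the restriction of places is injective, the component of `β` at `r(w)`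
can be chosen according to the size of the component of `α` at `w` alone. -/
theorem exists_adele_valuation_eq {V : Ultrafilter (HeightOneSpectrum (𝓞 K))}
    {α : AdeleRing (𝓞 K) K} (hα : ∀ᶠ w in V, Valued.v (α.2 w) ≤ 1) :
    ∃ β : AdeleRing (𝓞 F) F,
      ∀ᶠ w in V, Valued.v (β.2 (restrictPlace F w)) = Valued.v (α.2 w) := by
  obtain ⟨W, hW, hinj⟩ := exists_mem_injOn V (restrictPlace F) _ (encard_restrictPlace_fiber_le F K)
  have hex (v : HeightOneSpectrum (𝓞 F)) : ∃ x : v.adicCompletion F, Valued.v x ≤ 1 ∧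
      ∀ w ∈ W, Valued.v (α.2 w) ≤ 1 → restrictPlace F w = v →
        Valued.v x = Valued.v (α.2 w) := by
    by_cases hv : ∃ w ∈ W, Valued.v (α.2 w) ≤ 1 ∧ restrictPlace F w = v
    · obtain ⟨w, hw, hle, rfl⟩ := hv
      obtain ⟨x, hx⟩ := valuedAdicCompletion_surjective F (restrictPlace F w) (Valued.v (α.2 w))
      refine ⟨x, hx ▸ hle, fun w' hw' _ h => ?_⟩
      rw [hx, hinj hw' hw h]
    · exact ⟨0, by simp, fun w hw hle h => (hv ⟨w, hw, hle, h⟩).elim⟩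
  choose f hf1 hf2 using hex
  refine ⟨integralAdele f hf1, ?_⟩
  filter_upwards [hW, hα] with w hw hle
  exact hf2 _ w hw hle rfl

variable {U : Ultrafilter (HeightOneSpectrum (𝓞 F))} {V : Ultrafilter (HeightOneSpectrum (𝓞 K))}

theorem adeleMap_mem_maximalSet (hVU : V.map (restrictPlace F) = U) {β : AdeleRing (𝓞 F) F}
    (hβ : β ∈ maximalSet U) : adeleMap F K β ∈ maximalSet V := by
  subst hVU
  have hβ' : ∀ᶠ w : HeightOneSpectrum (𝓞 K) in V, Valued.v (β.2 (restrictPlace F w)) < 1 := hβ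
  refine mem_maximalSet.2 (hβ'.mono fun w hw => ?_)
  rw [valuation_adeleMap]
  exact pow_lt_one₀ zero_le hw (placeRamificationIdx_ne_zero F K w)

/-- A prime ideal inside `M_U` is recovered from the union of the sets `p_V^β` in `𝔸_K`: an inequality
of valuations at `w` descends to `r(w)` because `t ↦ t ^ e` is strictly monotone. -/
theorem mem_of_adeleMap_mem_primeSet {p : Ideal (AdeleRing (𝓞 F) F)} (hp : p.IsPrime)
    (hpU : (p : Set (AdeleRing (𝓞 F) F)) ⊆ maximalSet U) (hVU : V.map (restrictPlace F) = U)
    {α β : AdeleRing (𝓞 F) F} (hβ : β ∈ p) (h : adeleMap F K α ∈ primeSet V (adeleMap F K β)) :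
    α ∈ p := by
  subst hVU
  obtain ⟨n, hn, h⟩ := mem_primeSet.1 h
  refine primeSet_subset hp hpU hβ (mem_primeSet.2 ⟨n, hn, ?_⟩)
  refine (h.mono fun w hw => ?_ : ∀ᶠ w : HeightOneSpectrum (𝓞 K) in V,
    Valued.v (α.2 (restrictPlace F w)) ^ n ≤ Valued.v (β.2 (restrictPlace F w)))
  rw [valuation_adeleMap, valuation_adeleMap, ← pow_mul, mul_comm, pow_mul] at hw
  exact (pow_le_pow_iff_left₀ zero_le zero_le (placeRamificationIdx_ne_zero F K w)).1 hw

/-- Every element of a prime ideal inside `M_V` has the same size, up to bounded powers, as an element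
of that ideal coming from `𝔸_F`. -/
theorem exists_mem_primeSet_adeleMap {q : Ideal (AdeleRing (𝓞 K) K)} (hq : q.IsPrime)
    (hqV : (q : Set (AdeleRing (𝓞 K) K)) ⊆ maximalSet V) {α : AdeleRing (𝓞 K) K} (hα : α ∈ q) :
    ∃ β : AdeleRing (𝓞 F) F, adeleMap F K β ∈ q ∧ α ∈ primeSet V (adeleMap F K β) := by
  have hα1 : ∀ᶠ w in V, Valued.v (α.2 w) ≤ 1 := (mem_maximalSet.1 (hqV hα)).mono fun _ h => h.le
  obtain ⟨β, hβ⟩ := exists_adele_valuation_eq (F := F) hα1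
  refine ⟨β, mem_of_eventually_valuation_le hq hqV hα ?_,
    mem_primeSet.2 ⟨Module.finrank (𝓞 F) (𝓞 K), Module.finrank_pos, ?_⟩⟩
  · filter_upwards [hα1, hβ] with w h1 h2
    rw [valuation_adeleMap, h2]
    exact pow_le_of_le_one zero_le h1 (placeRamificationIdx_ne_zero F K w)
  · filter_upwards [hα1, hβ] with w h1 h2
    rw [valuation_adeleMap, h2]
    exact pow_le_pow_of_le_one zero_le h1 (placeRamificationIdx_le F K w)

end Extension

end AdelePrimes

theorem mainTheorem5 (K : Type*) [Field K] [NumberField K]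
    (U : Ultrafilter (HeightOneSpectrum (𝓞 ℚ))) (hU : ¬ AdelePrimes.IsPrincipal U)
    (p : Ideal (AdeleRing (𝓞 ℚ) ℚ)) (hp : p.IsPrime)
    (hpU : (p : Set (AdeleRing (𝓞 ℚ) ℚ)) ⊆ AdelePrimes.maximalSet U)
    (V : Ultrafilter (HeightOneSpectrum (𝓞 K)))
    (hV : V.map (AdelePrimes.restrictPlace ℚ) = U) :
    ∃ q : Ideal (AdeleRing (𝓞 K) K),
      (q.IsPrime ∧ (q : Set (AdeleRing (𝓞 K) K)) ⊆ AdelePrimes.maximalSet V ∧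
        q.comap (AdelePrimes.adeleMap ℚ K) = p) ∧
      (∀ q' : Ideal (AdeleRing (𝓞 K) K),
        q'.IsPrime → (q' : Set (AdeleRing (𝓞 K) K)) ⊆ AdelePrimes.maximalSet V →
          q'.comap (AdelePrimes.adeleMap ℚ K) = p → q' = q) ∧
      (q : Set (AdeleRing (𝓞 K) K)) =
        ⋃ β ∈ p, AdelePrimes.primeSet V (AdelePrimes.adeleMap ℚ K β) := by
  have hVc := AdelePrimes.le_cofinite_of_map_le_cofinite
    (hV ▸ AdelePrimes.le_cofinite_of_not_isPrincipal hU)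
  let B : Set (AdeleRing (𝓞 K) K) := AdelePrimes.adeleMap ℚ K '' p
  have hB : B.Nonempty := ⟨_, 0, p.zero_mem, rfl⟩
  have hBV : B ⊆ AdelePrimes.maximalSet V := by
    rintro _ ⟨β, hβ, rfl⟩
    exact AdelePrimes.adeleMap_mem_maximalSet hV (hpU hβ)
  let q := AdelePrimes.unionIdeal V hVc B hB
  have hq : (q : Set (AdeleRing (𝓞 K) K)) =
      ⋃ β ∈ p, AdelePrimes.primeSet V (AdelePrimes.adeleMap ℚ K β) :=
    Set.biUnion_image
  have hmem (α : AdeleRing (𝓞 K) K) :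
      α ∈ q ↔ ∃ β ∈ p, α ∈ AdelePrimes.primeSet V (AdelePrimes.adeleMap ℚ K β) := by
    rw [← SetLike.mem_coe, hq, Set.mem_iUnion₂]
    simp only [exists_prop]
  refine ⟨q, ⟨AdelePrimes.unionIdeal_isPrime hVc hB hBV,
    AdelePrimes.unionIdeal_subset_maximalSet hVc hB hBV, ?_⟩, fun q' hq' hqV hcomap => ?_, hq⟩
  · ext α
    rw [Ideal.mem_comap, hmem]
    constructor
    · rintro ⟨β, hβ, h⟩
      exact AdelePrimes.mem_of_adeleMap_mem_primeSet hp hpU hV hβ h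
    · exact fun hα => ⟨α, hα, AdelePrimes.mem_primeSet.2
        ⟨1, le_rfl, Filter.Eventually.of_forall fun v => (pow_one _).le⟩⟩
  · ext α
    rw [hmem]
    constructor
    · intro hα
      obtain ⟨β, hβ, h⟩ := AdelePrimes.exists_mem_primeSet_adeleMap (F := ℚ) hq' hqV hα
      exact ⟨β, hcomap ▸ Ideal.mem_comap.2 hβ, h⟩
    · rintro ⟨β, hβ, h⟩
      exact AdelePrimes.primeSet_subset hq' hqV (Ideal.mem_comap.1 (hcomap.symm ▸ hβ)) h
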